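/- Let $\Lambda$ be a finite set of sites, let $E$ be a set of two-element subsets of $\Lambda$, and for each $\{i,j\}\in E$ let $\lambda_{ij}>0$. The symmetric exclusion process (SEP) with these rates is the continuous-time Markov chain on $\{0,1\}^\Lambda$ in which each $\{i,j\}\in E$ carries a Poisson clock of rate $\lambda_{ij}$, the clocks being independent of one another and of the initial state, and whenever the clock of $\{i,j\}$ rings the current state $S:\Lambda\to\{0,1\}$ is replaced by $S\circ\tau_{ij}$, where $\tau_{ij}$ is the permutation of $\Lambda$ that exchanges $i$ and $j$ and fixes all other sites. Let $\varphi_t$ be the distribution of the state at time $t\ge 0$. An event $\mathcal{E}\subseteq\{0,1\}^\Lambda$ is increasing if $S\in\mathcal{E}$ and $S\le S'$ (pointwise) imply $S'\in\mathcal{E}$. Events $\mathcal{E},\mathcal{F}$ are disjointly supported if there is a partition $\Lambda=A\cup B$, $A\cap B=\varnothing$, such that $\mathcal{E}=\mathcal{E}'\times\{0,1\}^B$ and $\mathcal{F}=\{0,1\}^A\times\mathcal{F}'$ for some $\mathcal{E}'\subseteq\{0,1\}^A$ and $\mathcal{F}'\subseteq\{0,1\}^B$. A probability distribution on $\{0,1\}^\Lambda$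 is negatively associated if $\Pr[\mathcal{E}\cap\mathcal{F}]\le\Pr[\mathcal{E}]\cdot\Pr[\mathcal{F}]$ for any two increasing, disjointly supported events $\mathcal{E},\mathcal{F}$. **Theorem.** If the initial distribution $\varphi_0$ of the SEP is deterministic (i.e. concentrated on a single state), then $\varphi_t$ is negatively associated for all $t\ge 0$. -/

import Mathlib

open MeasureTheory ProbabilityTheory
open scoped NNReal

/-- States of a system with set of sites `Λ`: `S i = true` means that the site `i` is occupied and
`S i = false` that it is vacant. The order is the pointwise one, with `false ≤ true`. -/
abbrev SiteState (Λ : Type*) : Type _ := Λ → Bool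

/-- The transposition `τ_{ij}` of the set of sites that belongs to the unordered pair `{i, j}`. -/
def pairSwap {Λ : Type*} [DecidableEq Λ] (e : Sym2 Λ) : Equiv.Perm Λ :=
  Sym2.lift ⟨fun i j => Equiv.swap i j, fun i j => Equiv.swap_comm i j⟩ e

/-- `N` is (the counting process of) a homogeneous Poisson process of rate `r`; `N t` is the number
of rings of the clock in the time interval `(0, t]`. -/
structure IsPoissonClock {Ω : Type*} [MeasurableSpace Ω] (P : Measure Ω) (r : ℝ≥0)
    (N : ℝ≥0 → Ω → ℕ) : Prop where
  measurable : ∀ t, Measurable (N t)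
  zero : ∀ᵐ ω ∂P, N 0 ω = 0
  monotone : ∀ᵐ ω ∂P, Monotone (fun t => N t ω)
  rightContinuous : ∀ᵐ ω ∂P, ∀ t, ContinuousWithinAt (fun s => N s ω) (Set.Ici t) t
  indepIncrements : HasIndepIncrements N P
  law : ∀ s t, s ≤ t → P.map (fun ω => N t ω - N s ω) = poissonMeasure (r * (t - s))

/-- `X` is a symmetric exclusion process on the set of sites `Λ`, driven by the clocks `N`.
The set `E` of two-element subsets of `Λ` is the edge set of the graph `G`, and `rate e > 0` is the
rate of the clock of the pair `e`. The clocks are independent Poisson processes, they are jointly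
independent of the initial state, and whenever the clock of `e` rings the current state `S` is
replaced by `S ∘ τ_e`; the state does not change at other times.

Almost surely every clock rings finitely often in bounded time and no two clocks ring at the same
time, so that every time interval splits into finitely many intervals `(s, t]` with at most one
ring in each; hence `noRing` and `oneRing` together say precisely how the state is updated. -/
structure IsSymmetricExclusionProcess {Λ : Type*} [DecidableEq Λ] {Ω : Type*} [MeasurableSpace Ω]
    (P : Measure Ω) (G : SimpleGraph Λ) (rate : G.edgeSet → ℝ≥0)
    (N : G.edgeSet → ℝ≥0 → Ω → ℕ) (X : ℝ≥0 → Ω → SiteState Λ) : Prop where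
  rate_pos : ∀ e, 0 < rate e
  clock : ∀ e, IsPoissonClock P (rate e) (N e)
  indepClocks : iIndepFun (fun (e : G.edgeSet) (ω : Ω) (t : ℝ≥0) => N e t ω) P
  measurable : ∀ t, Measurable (X t)
  indepInitial : IndepFun (X 0) (fun (ω : Ω) (e : G.edgeSet) (t : ℝ≥0) => N e t ω) P
  noRing : ∀ᵐ ω ∂P, ∀ s t, s ≤ t → (∀ e, N e t ω = N e s ω) → X t ω = X s ω
  oneRing : ∀ᵐ ω ∂P, ∀ s t, s ≤ t → ∀ e, N e t ω = N e s ω + 1 →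
    (∀ e', e' ≠ e → N e' t ω = N e' s ω) → X t ω = X s ω ∘ pairSwap (e : Sym2 Λ)

/-- Two events are disjointly supported if, for some partition `Λ = A ∪ B` with `A ∩ B = ∅`, they
have the form `ℰ = ℰ' × {0,1}^B` and `ℱ = {0,1}^A × ℱ'` with `ℰ' ⊆ {0,1}^A`, `ℱ' ⊆ {0,1}^B`. -/
def DisjointlySupported {Λ : Type*} (ℰ ℱ : Set (SiteState Λ)) : Prop :=
  ∃ A B : Set Λ, A ∪ B = Set.univ ∧ A ∩ B = ∅ ∧
    (∃ ℰ' : Set (SiteState A), ℰ = {S | (fun i : A => S i) ∈ ℰ'}) ∧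
    (∃ ℱ' : Set (SiteState B), ℱ = {S | (fun i : B => S i) ∈ ℱ'})

/-- Negative association of a probability distribution on `{0,1}^Λ`, for finite `Λ` (so that every
set of states is measurable). Increasing events are upper sets. -/
def NegativelyAssociated {Λ : Type*} (φ : Measure (SiteState Λ)) : Prop :=
  ∀ ℰ ℱ : Set (SiteState Λ), IsUpperSet ℰ → IsUpperSet ℱ → DisjointlySupported ℰ ℱ →
    φ (ℰ ∩ ℱ) ≤ φ ℰ * φ ℱ

/-! The argument follows Borcea, Brändén and Liggett. Call a weight `w` on states stable if its
generating polynomial, the sum over `S` of `w S` times the product of the `z_i` with `S i = true`,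
has no zero with all `z_i` in the open upper half-plane. A point mass gives a monomial, which is
stable. Exchanging two sites with probability `p` turns `f` into `(1 - p) f + p (f ∘ τ)`. This
preserves stability, by a statement about two-variable multi-affine polynomials
(`partialSwap_ne_zero`), and it preserves the particle number.

Stability together with a fixed particle number gives negative association by an induction of
Feder–Mihail type. Stability survives, in a closed form, conditioning on the values of sites, and it
makes distinct sites negatively correlated. A fixed particle number makes the covariances of any
function with the occupation numbers sum to zero, so some site has non-negative covariance;
conditioning on that site reduces the support.

For the process itself, cut `[0, t]` into `n` steps. Outside an event of probability `O(1/n)` each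
step has at most one ring, and the state then comes from transpositions applied independent random
numbers of times, so its law is replaced by a stable one. The inequality passes to the limit `n →
∞`. -/

/-! ### Partial swaps of two-variable multi-affine polynomials. -/

section TwoVariables

open Complex

/-- For `b ≠ 0` the roots satisfy `x + y = k + l * (x * y)`, that is `x = (k - y) / (1 - l * y)`. If
`re y ≤ 0`, numerator and denominator have positive real parts and imaginary parts of the same sign,
so `re x > 0`. -/
lemma exists_root_re_pos (b c : ℂ) {k l : ℝ} (hk : 0 < k) (hl : 0 < l) :
    ∃ x : ℂ, 0 < x.re ∧ b * x ^ 2 - (b * k + c * l) * x + c = 0 := by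
  have hlC : (l : ℂ) ≠ 0 := by exact_mod_cast hl.ne'
  by_cases hb : b = 0
  · refine ⟨(l : ℂ)⁻¹, ?_, ?_⟩
    · rw [← ofReal_inv, ofReal_re]; positivity
    · subst hb; field_simp; ring
  · obtain ⟨s, hs⟩ := IsAlgClosed.exists_pow_nat_eq
      ((b * k + c * l) ^ 2 - 4 * b * c) (n := 2) (by norm_num)
    obtain ⟨x, hx⟩ : ∃ x, x = ((b * k + c * l) + s) / (2 * b) := ⟨_, rfl⟩
    obtain ⟨y, hy⟩ : ∃ y, y = ((b * k + c * l) - s) / (2 * b) := ⟨_, rfl⟩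
    have hxr : b * x ^ 2 - (b * k + c * l) * x + c = 0 := by
      rw [hx]; field_simp; linear_combination hs
    have hyr : b * y ^ 2 - (b * k + c * l) * y + c = 0 := by
      rw [hy]; field_simp; linear_combination hs
    have hc : c = b * (x * y) := by
      rw [hx, hy]; field_simp; linear_combination hs
    have hrel : x * (1 - l * y) = k - y := by
      have : x + y = k + l * (x * y) := by
        apply mul_left_cancel₀ hb
        have : b * (x + y) = b * k + c * l := by rw [hx, hy]; field_simp; ring
        rw [this, hc]; ring
      linear_combination this
    by_cases hy0 : 0 < y.re
    · exact ⟨y, hy0, hyr⟩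
    · refine ⟨x, ?_, hxr⟩
      push Not at hy0
      have h2 : x * (normSq (1 - l * y) : ℂ) = (k - y) * (starRingEnd ℂ) (1 - l * y) := by
        rw [← hrel, mul_assoc, mul_conj]
      have h3 := congrArg re h2
      rw [re_mul_ofReal] at h3
      simp only [map_sub, map_one, map_mul, conj_ofReal, mul_re, sub_re, ofReal_re, one_re,
        conj_re, ofReal_im, conj_im, sub_im, one_im, mul_im] at h3
      have h4 : 0 < normSq (1 - l * y) := by
        rw [normSq_pos]
        intro h
        have := congrArg re h
        simp at this
        nlinarith
      by_contra hxn
      push Not at hxn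
      have h5 : x.re * normSq (1 - l * y) ≤ 0 := mul_nonpos_of_nonpos_of_nonneg hxn h4.le
      rw [h3] at h5
      have : (k - y.re) * (1 - l * y.re) + l * y.im ^ 2 ≤ 0 := by
        refine le_trans (le_of_eq ?_) h5
        ring
      have : 0 < (k - y.re) * (1 - l * y.re) := by
        apply mul_pos
        · linarith
        · nlinarith
      nlinarith [mul_nonneg hl.le (sq_nonneg y.im)]

/-- With `s = √(y * v)`, the swapped polynomial at `(I * y, I * v)` equals the original one at `(I *
s * x, I * s / x)` for a suitable `x`: the product of the coordinates agrees, and matching the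
linear parts is the quadratic equation of `exists_root_re_pos`. Since `re x > 0`, both new points
lie in the upper half-plane. -/
lemma partialSwap_ne_zero_of_imaginary {a b c d : ℂ} {p q : ℝ} (hp : 0 ≤ p) (hq : 0 ≤ q)
    (hpq : p + q = 1)
    (h : ∀ z w : ℂ, 0 < z.im → 0 < w.im → a + b * z + c * w + d * (z * w) ≠ 0)
    {y v : ℝ} (hy : 0 < y) (hv : 0 < v) :
    a + (q * b + p * c) * (I * y) + (q * c + p * b) * (I * v) + d * ((I * y) * (I * v)) ≠ 0 := by
  intro h0
  have hs : 0 < √(y * v) := Real.sqrt_pos.2 (mul_pos hy hv)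
  have hs2 : √(y * v) ^ 2 = y * v := Real.sq_sqrt (mul_pos hy hv).le
  set s := √(y * v)
  have pos : ∀ y v : ℝ, 0 < y → 0 < v → 0 < q * y + p * v := by
    intro y v hy hv
    rcases hp.eq_or_lt with rfl | hp
    · have : q = 1 := by linarith
      subst this; simpa using hy
    · have := mul_pos hp hv
      have := mul_nonneg hq hy.le
      linarith
  obtain ⟨x, hx, hr⟩ := exists_root_re_pos b c (div_pos (pos y v hy hv) hs)
    (div_pos (pos v y hv hy) hs)
  have hx0 : x ≠ 0 := by rintro rfl; simp at hx
  have hsC : (s : ℂ) ≠ 0 := by exact_mod_cast hs.ne'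
  have hs2C : (s : ℂ) ^ 2 = y * v := by exact_mod_cast hs2
  apply h (I * s * x) (I * s * x⁻¹)
  · rw [mul_assoc, I_mul_im, re_ofReal_mul]; positivity
  · rw [mul_assoc, I_mul_im, re_ofReal_mul, inv_re]
    have := normSq_pos.2 hx0
    positivity
  · have e1 : (b * x ^ 2 + c) * s = (b * (q * y + p * v) + c * (q * v + p * y)) * x := by
      push_cast at hr
      field_simp at hr
      linear_combination hr
    have e2 : a + b * (I * s * x) + c * (I * s * x⁻¹) + d * (I * s * x * (I * s * x⁻¹))
        = a + I * ((b * x ^ 2 + c) * s) * x⁻¹ + I ^ 2 * (d * s ^ 2) := by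
      field_simp
      ring
    rw [e2, e1, hs2C, ← h0]
    field_simp
    ring

/-- The Möbius map `Z ↦ ((x₀ + R) * Z + (x₀ - R)) / (Z + 1)` has determinant `2 * R > 0` and carries
the positive imaginary axis onto the semicircle with centre `x₀` and radius `R`. -/
lemma exists_axis_coord {x₀ R : ℝ} (hR : 0 < R) {z : ℂ} (hz : 0 < z.im)
    (h : (z.re - x₀) ^ 2 + z.im ^ 2 = R ^ 2) :
    ∃ y : ℝ, 0 < y ∧ z * (I * y + 1) = (x₀ + R) * (I * y) + (x₀ - R) := by
  have hD : 0 < (x₀ + R - z.re) ^ 2 + z.im ^ 2 := by positivity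
  obtain ⟨y, hy⟩ : ∃ y, y = 2 * R * z.im / ((x₀ + R - z.re) ^ 2 + z.im ^ 2) := ⟨_, rfl⟩
  refine ⟨y, by rw [hy]; positivity, ?_⟩
  apply Complex.ext
  · simp only [mul_re, add_re, I_re, ofReal_re, I_im, ofReal_im, one_re, add_im, mul_im, one_im,
      sub_re]
    rw [hy]
    field_simp
    linear_combination (z.re - x₀ - R) * h
  · simp only [mul_re, add_re, I_re, ofReal_re, I_im, ofReal_im, one_re, add_im, mul_im, one_im,
      sub_im]
    rw [hy]
    field_simp
    linear_combination z.im * h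

lemma im_pos_of_axis_coord {x₀ R : ℝ} (hR : 0 < R) {Z : ℂ} (hZ : 0 < Z.im) :
    0 < (((x₀ + R) * Z + (x₀ - R)) / (Z + 1) : ℂ).im := by
  have h1 : Z + 1 ≠ 0 := by
    intro h
    have := congrArg im h
    simp at this
    linarith
  have h2 := normSq_pos.2 h1
  have : (((x₀ + R) * Z + (x₀ - R)) / (Z + 1) : ℂ).im = 2 * R * Z.im / normSq (Z + 1) := by
    rw [div_im]
    simp
    field_simp
    ring
  rw [this]
  positivity

/-- Partially exchanging the two variables of a two-variable multi-affine polynomial preserves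
non-vanishing on the product of two open upper half-planes. -/
lemma partialSwap_ne_zero {a b c d : ℂ} {p q : ℝ} (hp : 0 ≤ p) (hq : 0 ≤ q)
    (hpq : p + q = 1)
    (h : ∀ z w : ℂ, 0 < z.im → 0 < w.im → a + b * z + c * w + d * (z * w) ≠ 0)
    {z w : ℂ} (hz : 0 < z.im) (hw : 0 < w.im) :
    a + (q * b + p * c) * z + (q * c + p * b) * w + d * (z * w) ≠ 0 := by
  have hpqC : (p : ℂ) + q = 1 := by exact_mod_cast hpq
  -- The points `z` and `w` lie on a common vertical line or on a semicircle centred on the real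
  -- axis. A real translation or Möbius map moves it to the imaginary axis, and partial swapping
  -- commutes with applying one such map to both variables.
  by_cases hre : z.re = w.re
  · have key := partialSwap_ne_zero_of_imaginary (a := a + (b + c) * z.re + d * z.re ^ 2)
      (b := b + d * z.re) (c := c + d * z.re) (d := d) hp hq hpq ?_ hz hw
    · have e1 : z = z.re + I * z.im := by rw [mul_comm]; exact (re_add_im z).symm
      have e2 : w = z.re + I * w.im := by rw [hre, mul_comm]; exact (re_add_im w).symm
      intro h0
      apply key
      rw [← h0]
      linear_combination (d * z.re * I * z.im + d * z.re * I * w.im - z.re * (b + c)) * hpqC -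
        (q * b + p * c + d * w) * e1 - (q * c + p * b + d * (z.re + I * z.im)) * e2
    · intro Z W hZ hW h0
      apply h (Z + z.re) (W + z.re) (by simpa) (by simpa)
      rw [← h0]; ring
  · have hre' : z.re - w.re ≠ 0 := sub_ne_zero.2 hre
    obtain ⟨x₀, hx₀⟩ : ∃ x₀ : ℝ, x₀ = ((z.re ^ 2 + z.im ^ 2) - (w.re ^ 2 + w.im ^ 2)) /
      (2 * (z.re - w.re)) := ⟨_, rfl⟩
    have hpos : 0 < (z.re - x₀) ^ 2 + z.im ^ 2 := by positivity
    obtain ⟨R, hRdef⟩ : ∃ R, R = √((z.re - x₀) ^ 2 + z.im ^ 2) := ⟨_, rfl⟩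
    have hR : 0 < R := hRdef ▸ Real.sqrt_pos.2 hpos
    have hzR : (z.re - x₀) ^ 2 + z.im ^ 2 = R ^ 2 := by rw [hRdef, Real.sq_sqrt hpos.le]
    have hwR : (w.re - x₀) ^ 2 + w.im ^ 2 = R ^ 2 := by
      rw [← hzR]
      have : x₀ * (2 * (z.re - w.re)) = (z.re ^ 2 + z.im ^ 2) - (w.re ^ 2 + w.im ^ 2) := by
        rw [hx₀]; field_simp
      linear_combination this
    obtain ⟨y, hy, ey⟩ := exists_axis_coord hR hz hzR
    obtain ⟨v, hv, ev⟩ := exists_axis_coord hR hw hwR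
    -- The coefficients are those of the transformed polynomial multiplied by `(Z + 1) * (W + 1)`.
    have key := partialSwap_ne_zero_of_imaginary
      (a := a + (b + c) * (x₀ - R) + d * (x₀ - R) ^ 2)
      (b := a + b * (x₀ + R) + c * (x₀ - R) + d * (x₀ - R) * (x₀ + R))
      (c := a + b * (x₀ - R) + c * (x₀ + R) + d * (x₀ - R) * (x₀ + R))
      (d := a + (b + c) * (x₀ + R) + d * (x₀ + R) ^ 2) hp hq hpq ?_ hy hv
    · intro h0
      apply key
      have e : (I * y + 1) * (I * v + 1) *
          (a + (q * b + p * c) * z + (q * c + p * b) * w + d * (z * w)) = 0 := by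
        rw [h0, mul_zero]
      rw [← e]
      have hq' : (q : ℂ) = 1 - p := by rw [← hpqC]; ring
      rw [hq']
      linear_combination (-(I * v + 1) * ((1 - p) * b + p * c) - d * (w * (I * v + 1))) * ey +
        (-(I * y + 1) * ((1 - p) * c + p * b) - d * ((x₀ + R) * (I * y) + (x₀ - R))) * ev
    · intro Z W hZ hW h0
      have hZ1 : Z + 1 ≠ 0 := by
        intro h
        have := congrArg im h
        simp at this
        linarith
      have hW1 : W + 1 ≠ 0 := by
        intro h
        have := congrArg im h
        simp at this
        linarith
      apply h _ _ (im_pos_of_axis_coord (x₀ := x₀) hR hZ) (im_pos_of_axis_coord (x₀ := x₀) hR hW)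
      field_simp
      linear_combination h0

end TwoVariables

/-! ### Generating polynomials and half-plane stability. -/

section Stability

variable {Λ : Type*} [Fintype Λ] [DecidableEq Λ]

/-- The generating polynomial `∑ w(S) ∏_{i ∈ S} z_i` of a weight on states. -/
noncomputable def genPoly (w : SiteState Λ → ℝ) (z : Λ → ℂ) : ℂ :=
  ∑ S, (w S : ℂ) * ∏ i, if S i then z i else 1

/-- The generating polynomial has no zero whose coordinates all lie in the open upper
half-plane. -/
def HalfPlaneStable (w : SiteState Λ → ℝ) : Prop :=
  ∀ z : Λ → ℂ, (∀ i, 0 < (z i).im) → genPoly w z ≠ 0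

lemma prod_update_site (S : SiteState Λ) (z : Λ → ℂ) (i : Λ) (x : ℂ) :
    (∏ j, if S j then Function.update z i x j else 1) =
      (if S i then x else 1) * ∏ j ∈ {i}ᶜ, (if S j then z j else 1) := by
  rw [Fintype.prod_eq_mul_prod_compl i]
  congr 1
  · simp
  · refine Finset.prod_congr rfl fun j hj => ?_
    have : j ≠ i := by simpa using hj
    rw [Function.update_of_ne this]

lemma genPoly_update (w : SiteState Λ → ℝ) (z : Λ → ℂ) (i : Λ) (x : ℂ) :
    genPoly w (Function.update z i x) = genPoly w (Function.update z i 0) +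
      x * (genPoly w (Function.update z i 1) - genPoly w (Function.update z i 0)) := by
  simp only [genPoly, prod_update_site]
  rw [← Finset.sum_sub_distrib, Finset.mul_sum, ← Finset.sum_add_distrib]
  refine Finset.sum_congr rfl fun S _ => ?_
  by_cases h : S i <;> simp [h]
  ring

lemma genPoly_add (w w' : SiteState Λ → ℝ) (z : Λ → ℂ) :
    genPoly (w + w') z = genPoly w z + genPoly w' z := by
  simp [genPoly, add_mul, Finset.sum_add_distrib]

lemma genPoly_smul (r : ℝ) (w : SiteState Λ → ℝ) (z : Λ → ℂ) :
    genPoly (r • w) z = r * genPoly w z := by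
  simp [genPoly, Finset.mul_sum, mul_assoc]

lemma genPoly_comp_perm (w : SiteState Λ → ℝ) (σ : Equiv.Perm Λ) (z : Λ → ℂ) :
    genPoly (fun S => w (S ∘ σ)) z = genPoly w (z ∘ σ) := by
  unfold genPoly
  refine Fintype.sum_equiv (Equiv.arrowCongr σ.symm (Equiv.refl _)) _ _ fun S => ?_
  have h : (Equiv.arrowCongr σ.symm (Equiv.refl Bool)) S = S ∘ σ := by
    ext; simp
  rw [h]
  congr 1
  exact (Equiv.prod_comp σ (fun i => if S i then z i else 1)).symm

/-- Exchange the sites by `σ` with probability `p`. -/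
def partialSwap (p : ℝ) (σ : Equiv.Perm Λ) (w : SiteState Λ → ℝ) : SiteState Λ → ℝ :=
  (1 - p) • w + p • fun S => w (S ∘ σ)

/-- Freezing all variables except `z i` and `z j` leaves a two-variable multi-affine polynomial, to
which `partialSwap_ne_zero` applies. -/
lemma HalfPlaneStable.partialSwap {w : SiteState Λ → ℝ} (hw : HalfPlaneStable w) {p : ℝ}
    (hp : 0 ≤ p) (hp1 : p ≤ 1) {i j : Λ} (hij : i ≠ j) :
    HalfPlaneStable (partialSwap p (Equiv.swap i j) w) := by
  intro z hz
  obtain ⟨G, hG⟩ : ∃ G : ℂ → ℂ → ℂ,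
      G = fun x y => genPoly w (Function.update (Function.update z i x) j y) := ⟨_, rfl⟩
  have hGe : ∀ x y, G x y = G 0 0 + (G 1 0 - G 0 0) * x + (G 0 1 - G 0 0) * y +
      (G 1 1 - G 1 0 - G 0 1 + G 0 0) * (x * y) := by
    intro x y
    have h1 : ∀ x y, G x y = G x 0 + y * (G x 1 - G x 0) := by
      intro x y; simp only [hG]; exact genPoly_update _ _ _ _
    have h2 : ∀ x y, G x y = G 0 y + x * (G 1 y - G 0 y) := by
      intro x y
      simp only [hG]
      rw [Function.update_comm hij, Function.update_comm hij, Function.update_comm hij]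
      exact genPoly_update _ _ _ _
    rw [h1, h2 x 0, h2 x 1]
    ring
  have hGz : genPoly w z = G (z i) (z j) := by simp [hG]
  have hGs : genPoly w (z ∘ Equiv.swap i j) = G (z j) (z i) := by
    rw [hG, Equiv.comp_swap_eq_update, Function.update_comm hij.symm]
  unfold _root_.partialSwap
  rw [genPoly_add, genPoly_smul, genPoly_smul, genPoly_comp_perm, hGz, hGs]
  have := partialSwap_ne_zero (a := G 0 0) (b := G 1 0 - G 0 0) (c := G 0 1 - G 0 0)
    (d := G 1 1 - G 1 0 - G 0 1 + G 0 0) hp (sub_nonneg.2 hp1) (by ring) ?_ (hz i) (hz j)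
  · intro h0
    apply this
    rw [hGe (z i) (z j), hGe (z j) (z i)] at h0
    push_cast at h0 ⊢
    linear_combination h0
  · intro x y hx hy
    rw [← hGe, hG]
    apply hw
    intro k
    by_cases hk : k = j
    · subst hk; simpa
    · by_cases hk' : k = i
      · subst hk'; simpa [hk]
      · simpa [hk, hk'] using hz k

lemma halfPlaneStable_single (S₀ : SiteState Λ) : HalfPlaneStable (Pi.single S₀ (1 : ℝ)) := by
  intro z hz
  unfold genPoly
  rw [Finset.sum_eq_single S₀]
  · simp only [Pi.single_eq_same, Complex.ofReal_one, one_mul]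
    refine Finset.prod_ne_zero_iff.2 fun i _ => ?_
    split_ifs
    · intro h
      have := hz i
      simp [h] at this
    · exact one_ne_zero
  · intro S _ hS; simp [Pi.single_eq_of_ne hS]
  · simp

end Stability

/-! ### Unnormalised conditioning on the value of a site. -/

section Restriction

variable {Λ : Type*}

/-- The part of the weight `w` that is carried by the states `S` with `S i = b`. -/
def restrictSite (i : Λ) (b : Bool) (w : SiteState Λ → ℝ) : SiteState Λ → ℝ :=
  fun S => if S i = b then w S else 0

lemma restrictSite_comm (i j : Λ) (b c : Bool) (w : SiteState Λ → ℝ) :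
    restrictSite i b (restrictSite j c w) = restrictSite j c (restrictSite i b w) := by
  ext S
  simp only [restrictSite]
  split_ifs <;> rfl

lemma restrictSite_add_restrictSite (i : Λ) (w : SiteState Λ → ℝ) :
    restrictSite i false w + restrictSite i true w = w := by
  ext S
  cases h : S i <;> simp [restrictSite, h]

lemma restrictSite_of_eq (i : Λ) (b : Bool) {w : SiteState Λ → ℝ} (h : restrictSite i (!b) w = 0) :
    restrictSite i b w = w := by
  have := restrictSite_add_restrictSite i w
  cases b
  · rw [Bool.not_false] at h; rwa [h, add_zero] at this
  · rw [Bool.not_true] at h; rwa [h, zero_add] at this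

variable [Fintype Λ] [DecidableEq Λ]

lemma genPoly_restrictSite_false_update (w : SiteState Λ → ℝ) (z : Λ → ℂ) (i : Λ) (x : ℂ) :
    genPoly (restrictSite i false w) (Function.update z i x) =
      genPoly (restrictSite i false w) z := by
  conv_rhs => rw [← Function.update_eq_self i z]
  simp only [genPoly, prod_update_site]
  refine Finset.sum_congr rfl fun S _ => ?_
  by_cases h : S i <;> simp [restrictSite, h]

lemma genPoly_restrictSite_true_update (w : SiteState Λ → ℝ) (z : Λ → ℂ) (i : Λ) (x : ℂ) :
    genPoly (restrictSite i true w) (Function.update z i x) =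
      x * genPoly (restrictSite i true w) (Function.update z i 1) := by
  simp only [genPoly, prod_update_site, Finset.mul_sum]
  refine Finset.sum_congr rfl fun S _ => ?_
  by_cases h : S i <;> simp [restrictSite, h]
  ring

lemma genPoly_update_eq (w : SiteState Λ → ℝ) (z : Λ → ℂ) (i : Λ) (x : ℂ) :
    genPoly w (Function.update z i x) = genPoly (restrictSite i false w) z +
      x * genPoly (restrictSite i true w) (Function.update z i 1) := by
  conv_lhs => rw [← restrictSite_add_restrictSite i w]
  rw [genPoly_add, genPoly_restrictSite_false_update, genPoly_restrictSite_true_update]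

lemma genPoly_restrictSite_false (w : SiteState Λ → ℝ) (z : Λ → ℂ) (i : Λ) :
    genPoly (restrictSite i false w) z = genPoly w (Function.update z i 0) := by
  rw [genPoly_update_eq]; simp

lemma genPoly_restrictSite_true_update_one (w : SiteState Λ → ℝ) (z : Λ → ℂ) (i : Λ) :
    genPoly (restrictSite i true w) (Function.update z i 1) =
      genPoly w (Function.update z i 1) - genPoly w (Function.update z i 0) := by
  rw [genPoly_update_eq w z i 1, genPoly_update_eq w z i 0]; ring

lemma genPoly_restrictSite_true (w : SiteState Λ → ℝ) (z : Λ → ℂ) (i : Λ) :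
    genPoly (restrictSite i true w) z = z i *
      (genPoly w (Function.update z i 1) - genPoly w (Function.update z i 0)) := by
  conv_lhs => rw [← Function.update_eq_self i z]
  rw [genPoly_restrictSite_true_update, genPoly_restrictSite_true_update_one]

lemma continuous_genPoly (w : SiteState Λ → ℝ) : Continuous (genPoly w) := by
  unfold genPoly
  refine continuous_finsetSum _ fun S _ => continuous_const.mul ?_
  refine continuous_finsetProd _ fun i _ => ?_
  split_ifs
  · exact continuous_apply i
  · exact continuous_const

end Restriction

/-! ### Closed form of stability, its survival under conditioning, and pairwise negative
correlation. -/

section WeakStability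

variable {Λ : Type*} [Fintype Λ] [DecidableEq Λ]

/-- For `h ≠ 0` the only zero in `Z` is `-g / h = -(g * conj h) / |h|²`, which must stay out of the
open upper half-plane. -/
lemma im_mul_conj_nonneg_of_ne_zero {g h : ℂ} (H : ∀ Z : ℂ, 0 < Z.im → g + Z * h ≠ 0) :
    0 ≤ (g * (starRingEnd ℂ) h).im := by
  by_contra hneg
  push Not at hneg
  have hh : h ≠ 0 := by rintro rfl; simp at hneg
  have hn := Complex.normSq_pos.2 hh
  have hnC : (Complex.normSq h : ℂ) ≠ 0 := by exact_mod_cast hn.ne'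
  apply H (-(g * (starRingEnd ℂ) h) / (Complex.normSq h : ℂ))
  · rw [Complex.div_ofReal_im, Complex.neg_im]
    exact div_pos (by linarith) hn
  · have := Complex.mul_conj h
    field_simp
    linear_combination -g * this

/-- A closed form of half-plane stability, which also holds for the zero polynomial: if
`f = g + z_i h` is the expansion of the generating polynomial in the variable `z_i`, then
`Im (g * conj h) ≥ 0` whenever all variables lie in the closed upper half-plane. -/
def WeaklyStable (w : SiteState Λ → ℝ) : Prop :=
  ∀ (i : Λ) (z : Λ → ℂ), (∀ j, 0 ≤ (z j).im) →
    0 ≤ (genPoly w (Function.update z i 0) * (starRingEnd ℂ)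
      (genPoly w (Function.update z i 1) - genPoly w (Function.update z i 0))).im

lemma HalfPlaneStable.weaklyStable {w : SiteState Λ → ℝ} (hw : HalfPlaneStable w) :
    WeaklyStable w := by
  intro i z hz
  -- Shifting by `ε * I` moves the point into the open half-plane; then `ε → 0`.
  let zε : ℝ → Λ → ℂ := fun ε j => z j + ε * Complex.I
  let φ : ℝ → ℝ := fun ε => (genPoly w (Function.update (zε ε) i 0) * (starRingEnd ℂ)
      (genPoly w (Function.update (zε ε) i 1) - genPoly w (Function.update (zε ε) i 0))).im
  have hzε : Continuous zε := by fun_prop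
  have hc : ∀ x : ℂ, Continuous fun ε => genPoly w (Function.update (zε ε) i x) := fun x =>
    (continuous_genPoly w).comp (hzε.update i continuous_const)
  have hφ : Continuous φ := Complex.continuous_im.comp
    ((hc 0).mul (Complex.continuous_conj.comp ((hc 1).sub (hc 0))))
  have hpos : ∀ ε > 0, 0 ≤ φ ε := by
    intro ε hε
    apply im_mul_conj_nonneg_of_ne_zero
    intro Z hZ
    rw [← genPoly_update]
    apply hw
    intro k
    by_cases hk : k = i
    · subst hk; simpa using hZ
    · have := hz k
      simp [hk, zε]
      linarith
  have h0 : φ 0 = (genPoly w (Function.update z i 0) * (starRingEnd ℂ)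
      (genPoly w (Function.update z i 1) - genPoly w (Function.update z i 0))).im := by
    simp [φ, zε]
  rw [← h0]
  refine ge_of_tendsto (hφ.continuousWithinAt (s := Set.Ioi 0) (x := 0)) ?_
  filter_upwards [self_mem_nhdsWithin] with ε hε using hpos ε hε

lemma leading_coeff_nonneg {A B C : ℝ} (h : ∀ y : ℝ, 0 ≤ y → 0 ≤ A + B * y + C * y ^ 2) :
    0 ≤ C := by
  by_contra hC
  push Not at hC
  -- Chosen so that `C * y = C - (|A| + |B|)`, which bounds the quadratic by `C * y < 0`.
  set y := 1 + (|A| + |B|) / (-C)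
  have hy : 1 ≤ y := by
    have : 0 ≤ (|A| + |B|) / (-C) := div_nonneg (by positivity) (by linarith)
    simp only [y]; linarith
  have h1 := h y (by linarith)
  have h2 : C * y = C - (|A| + |B|) := by
    simp only [y]
    have : C ≠ 0 := hC.ne
    field_simp
    ring
  have h3 : A ≤ |A| * y := (le_abs_self A).trans (le_mul_of_one_le_right (abs_nonneg A) hy)
  have h4 : B * y ≤ |B| * y := mul_le_mul_of_nonneg_right (le_abs_self B) (by linarith)
  have h5 : C * y ^ 2 = (C - (|A| + |B|)) * y := by rw [← h2]; ring
  nlinarith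

/-- A vacant site `i` corresponds to the boundary value `z i = 0`. For an occupied one, put `z i = I
* y`: the expression is quadratic in `y`, and its leading coefficient is the expression for the
coefficient of `z i`. The remaining factor `z i` only contributes `|z i|²`. -/
lemma WeaklyStable.restrictSite {w : SiteState Λ → ℝ} (hw : WeaklyStable w) (i : Λ) (b : Bool) :
    WeaklyStable (restrictSite i b w) := by
  intro j z hz
  by_cases hji : j = i
  · subst hji
    cases b
    · simp [genPoly_restrictSite_false_update]
    · rw [genPoly_restrictSite_true_update _ _ _ 0]; simp
  cases b
  · simp only [genPoly_restrictSite_false, Function.update_comm hji]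
    apply hw
    intro k
    by_cases hk : k = i
    · subst hk; simp
    · simpa [hk] using hz k
  · simp only [genPoly_restrictSite_true, Function.update_of_ne (Ne.symm hji)]
    obtain ⟨F, hF⟩ : ∃ F : ℂ → ℂ → ℂ, F = fun x y =>
      genPoly w (Function.update (Function.update z i y) j x) := ⟨_, rfl⟩
    have hFc : ∀ x y, genPoly w (Function.update (Function.update z j x) i y) = F x y := by
      intro x y; rw [hF, Function.update_comm hji]
    have hFa : ∀ x y, F x y = F x 0 + y * (F x 1 - F x 0) := by
      intro x y; simp only [← hFc]; exact genPoly_update _ _ _ _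
    simp only [hFc]
    have hq : ∀ y : ℝ, 0 ≤ y → 0 ≤ (F 0 (Complex.I * y) * (starRingEnd ℂ)
        (F 1 (Complex.I * y) - F 0 (Complex.I * y))).im := by
      intro y hy
      rw [hF]
      apply hw
      intro k
      by_cases hk : k = i
      · subst hk; simpa
      · simpa [hk] using hz k
    have h1 : 0 ≤ ((F 0 1 - F 0 0) *
        (starRingEnd ℂ) ((F 1 1 - F 1 0) - (F 0 1 - F 0 0))).im := by
      refine leading_coeff_nonneg (A := (F 0 0 * (starRingEnd ℂ) (F 1 0 - F 0 0)).im)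
        (B := ((F 0 1 - F 0 0) * Complex.I * (starRingEnd ℂ) (F 1 0 - F 0 0) + F 0 0 *
          (starRingEnd ℂ) (Complex.I * ((F 1 1 - F 1 0) - (F 0 1 - F 0 0)))).im) fun y hy => ?_
      refine (hq y hy).trans (le_of_eq ?_)
      rw [hFa 0 (Complex.I * y), hFa 1 (Complex.I * y)]
      simp only [map_sub, map_add, map_mul, Complex.conj_I, Complex.conj_ofReal, Complex.mul_im,
        Complex.mul_re, Complex.add_re, Complex.add_im, Complex.sub_re, Complex.sub_im,
        Complex.conj_re, Complex.conj_im, Complex.I_re, Complex.I_im, Complex.ofReal_re,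
        Complex.ofReal_im, Complex.neg_re, Complex.neg_im]
      ring
    have h2 : (z i * (F 0 1 - F 0 0) * (starRingEnd ℂ)
        (z i * (F 1 1 - F 1 0) - z i * (F 0 1 - F 0 0))) = (Complex.normSq (z i) : ℂ) *
        ((F 0 1 - F 0 0) * (starRingEnd ℂ) ((F 1 1 - F 1 0) - (F 0 1 - F 0 0))) := by
      rw [← Complex.mul_conj, ← mul_sub, map_mul]
      ring
    rw [h2, Complex.im_ofReal_mul]
    exact mul_nonneg (Complex.normSq_nonneg _) h1

lemma genPoly_one (w : SiteState Λ → ℝ) : genPoly w 1 = ((∑ S, w S : ℝ) : ℂ) := by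
  simp [genPoly]

/-- At `z j = I` with all other variables equal to `1`, the imaginary part in `WeaklyStable` is the
difference of the two sides. -/
lemma WeaklyStable.sum_mul_sum_le {w : SiteState Λ → ℝ} (hw : WeaklyStable w) {i j : Λ}
    (hij : i ≠ j) :
    (∑ S, _root_.restrictSite i true (_root_.restrictSite j true w) S) *
        (∑ S, _root_.restrictSite i false (_root_.restrictSite j false w) S) ≤
      (∑ S, _root_.restrictSite i true (_root_.restrictSite j false w) S) *
        (∑ S, _root_.restrictSite i false (_root_.restrictSite j true w) S) := by
  have h := hw i (Function.update 1 j Complex.I) (by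
    intro k
    by_cases hk : k = j
    · subst hk; simp
    · simp [hk])
  have e1 : ∀ k : Λ, Function.update (1 : Λ → ℂ) k 1 = 1 := fun k => by
    simpa using Function.update_eq_self k (1 : Λ → ℂ)
  have key : ∀ v : SiteState Λ → ℝ, genPoly v (Function.update 1 j Complex.I) =
      ((∑ S, _root_.restrictSite j false v S : ℝ) : ℂ) +
        Complex.I * ((∑ S, _root_.restrictSite j true v S : ℝ) : ℂ) := fun v => by
    rw [genPoly_update_eq, e1, genPoly_one, genPoly_one]
  rw [← genPoly_restrictSite_true_update_one, ← genPoly_restrictSite_false,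
    Function.update_comm hij.symm, e1, key, key, restrictSite_comm j i,
    restrictSite_comm j i, restrictSite_comm j i, restrictSite_comm j i] at h
  simp only [map_add, map_mul, Complex.conj_I, Complex.conj_ofReal, Complex.mul_im,
    Complex.mul_re, Complex.add_re, Complex.add_im, Complex.I_re, Complex.I_im,
    Complex.ofReal_re, Complex.ofReal_im, Complex.neg_re, Complex.neg_im] at h
  linarith

end WeakStability

/-! ### From stability and a fixed particle number to negative association. -/

section NegativeAssociation

variable {Λ : Type*} [Fintype Λ] [DecidableEq Λ]

/-- Non-negative weakly stable weights that are carried by states with a fixed number of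
particles. -/
structure IsConservativeStable (w : SiteState Λ → ℝ) : Prop where
  nonneg : ∀ S, 0 ≤ w S
  stable : WeaklyStable w
  homogeneous : ∃ m : ℝ, ∀ S, w S ≠ 0 → (∑ i, if S i then (1 : ℝ) else 0) = m

lemma IsConservativeStable.restrictSite {w : SiteState Λ → ℝ} (hw : IsConservativeStable w)
    (i : Λ) (b : Bool) : IsConservativeStable (restrictSite i b w) := by
  refine ⟨fun S => ?_, hw.stable.restrictSite i b, ?_⟩
  · unfold _root_.restrictSite
    split_ifs
    exacts [hw.nonneg S, le_rfl]
  · obtain ⟨m, hm⟩ := hw.homogeneous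
    refine ⟨m, fun S hS => hm S fun h0 => hS ?_⟩
    simp [_root_.restrictSite, h0]

/-- The total mass of the weight `w`. -/
def mass (w : SiteState Λ → ℝ) : ℝ := ∑ S, w S

/-- The integral of `F` with respect to the weight `w`. -/
def wsum (w F : SiteState Λ → ℝ) : ℝ := ∑ S, w S * F S

lemma wsum_split (i : Λ) (w F : SiteState Λ → ℝ) :
    wsum w F = wsum (restrictSite i false w) F + wsum (restrictSite i true w) F := by
  conv_lhs => rw [← restrictSite_add_restrictSite i w]
  simp [wsum, add_mul, Finset.sum_add_distrib]

lemma mass_split (i : Λ) (w : SiteState Λ → ℝ) :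
    mass w = mass (restrictSite i false w) + mass (restrictSite i true w) := by
  conv_lhs => rw [← restrictSite_add_restrictSite i w]
  simp [mass, Finset.sum_add_distrib]

lemma mass_nonneg {w : SiteState Λ → ℝ} (hw : ∀ S, 0 ≤ w S) : 0 ≤ mass w :=
  Finset.sum_nonneg fun S _ => hw S

lemma eq_zero_of_mass_nonpos {w : SiteState Λ → ℝ} (hw : ∀ S, 0 ≤ w S) (h : mass w ≤ 0) :
    w = 0 := by
  have h0 : ∑ S, w S = 0 := le_antisymm h (mass_nonneg hw)
  ext S
  exact (Finset.sum_eq_zero_iff_of_nonneg fun S _ => hw S).1 h0 S (Finset.mem_univ S)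

lemma mass_pos {w : SiteState Λ → ℝ} (hw : ∀ S, 0 ≤ w S) {S : SiteState Λ} (h : w S ≠ 0) :
    0 < mass w :=
  Finset.sum_pos' (fun S _ => hw S) ⟨S, Finset.mem_univ S, (hw S).lt_of_ne' h⟩

/-- Makes the inductions on the size of the support decrease when the conditioning site takes both
values. -/
lemma card_support_restrictSite_lt {w : SiteState Λ → ℝ} (i : Λ) (b : Bool)
    (h : restrictSite i (!b) w ≠ 0) :
    (Finset.univ.filter fun S => restrictSite i b w S ≠ 0).card <
      (Finset.univ.filter fun S => w S ≠ 0).card := by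
  obtain ⟨S, hS⟩ := Function.ne_iff.1 h
  apply Finset.card_lt_card
  refine Finset.ssubset_iff_of_subset (fun T hT => ?_) |>.2 ⟨S, ?_, ?_⟩
  · simp only [Finset.mem_filter, Finset.mem_univ, true_and] at hT ⊢
    intro h0; apply hT; simp [restrictSite, h0]
  · simp only [Finset.mem_filter, Finset.mem_univ, true_and]
    intro h0; apply hS; simp [restrictSite, h0]
  · simp only [Finset.mem_filter, Finset.mem_univ, true_and, not_not]
    by_contra h0
    apply hS
    have : S i = b := by by_contra hb; exact h0 (by simp [restrictSite, hb])
    simp [restrictSite, this]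

/-- For a weight with a fixed particle number, the covariances of any function with the
occupation numbers sum to zero. -/
lemma IsConservativeStable.sum_cov_eq_zero {w : SiteState Λ → ℝ} (hw : IsConservativeStable w)
    (F : SiteState Λ → ℝ) :
    ∑ i, (wsum (_root_.restrictSite i true w) F * mass w -
      wsum w F * mass (_root_.restrictSite i true w)) = 0 := by
  obtain ⟨m, hm⟩ := hw.homogeneous
  have h1 : ∀ F : SiteState Λ → ℝ, ∑ i, wsum (_root_.restrictSite i true w) F = m * wsum w F := by
    intro F
    simp only [wsum]
    rw [Finset.sum_comm, Finset.mul_sum]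
    refine Finset.sum_congr rfl fun S _ => ?_
    by_cases h0 : w S = 0
    · simp [_root_.restrictSite, h0]
    · rw [← hm S h0, Finset.sum_mul]
      refine Finset.sum_congr rfl fun i _ => ?_
      simp only [_root_.restrictSite]
      split_ifs <;> simp
  have h2 : ∀ v : SiteState Λ → ℝ, mass v = wsum v 1 := fun v => by simp [mass, wsum]
  rw [Finset.sum_sub_distrib, ← Finset.sum_mul, ← Finset.mul_sum, h1]
  simp only [h2]
  rw [h1]
  ring

/-- Occupation numbers of distinct sites are negatively correlated. -/
lemma IsConservativeStable.mass_mul_le {w : SiteState Λ → ℝ} (hw : IsConservativeStable w)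
    {e f : Λ} (hef : e ≠ f) :
    mass (_root_.restrictSite e true (_root_.restrictSite f true w)) *
        mass (_root_.restrictSite f false w) ≤
      mass (_root_.restrictSite f true w) *
        mass (_root_.restrictSite e true (_root_.restrictSite f false w)) := by
  have := hw.stable.sum_mul_sum_le hef
  rw [mass_split e (_root_.restrictSite f false w), mass_split e (_root_.restrictSite f true w)]
  simp only [mass] at *
  linarith

lemma exists_nonneg_of_sum_nonneg {ι : Type*} [Fintype ι] {c : ι → ℝ} {p : ι → Prop}
    (hsum : 0 ≤ ∑ i, c i) (hc : ∀ i, ¬ p i → c i ≤ 0) (hp : ∃ i, p i) : ∃ i, p i ∧ 0 ≤ c i := by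
  by_contra! H
  obtain ⟨i, hi⟩ := hp
  have : ∑ i, c i < 0 := by
    refine Finset.sum_neg' (fun j _ => ?_) ⟨i, Finset.mem_univ i, H i hi⟩
    by_cases hj : p j
    exacts [(H j hj).le, hc j hj]
  linarith

/-- An increasing function is negatively correlated with the occupation number of any site on
which it does not depend. -/
lemma IsConservativeStable.wsum_restrictSite_mul_mass_le {w : SiteState Λ → ℝ}
    (hw : IsConservativeStable w) {F : SiteState Λ → ℝ} (hF : Monotone F) {A : Set Λ}
    (hFA : DependsOn F A) {e : Λ} (he : e ∉ A) :
    wsum (_root_.restrictSite e true w) F * mass w ≤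
      wsum w F * mass (_root_.restrictSite e true w) := by
  induction hn : (Finset.univ.filter fun S => w S ≠ 0).card using Nat.strong_induction_on
    generalizing w with
  | _ n ih =>
  subst hn
  set w₁ := _root_.restrictSite e true w with hw₁
  have gw₁ : IsConservativeStable w₁ := hw.restrictSite e true
  by_cases hK : ∃ f, f ≠ e ∧ 0 < mass (_root_.restrictSite f true w₁) ∧
      0 < mass (_root_.restrictSite f false w)
  -- The excluded sites have zero covariance with `F` under `w₁`: each is `e` itself, never occupied
  -- under `w₁`, or always occupied under `w`.
  · obtain ⟨f, ⟨hfe, hv, hu⟩, hcov⟩ := exists_nonneg_of_sum_nonneg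
      (gw₁.sum_cov_eq_zero F).ge (fun f hf => le_of_eq (by
        by_cases hfe : f = e
        · subst hfe
          have : _root_.restrictSite f true w₁ = w₁ := by
            ext S; simp only [hw₁, _root_.restrictSite]; split_ifs <;> rfl
          rw [this]; ring
        by_cases hv : 0 < mass (_root_.restrictSite f true w₁)
        · have hu : _root_.restrictSite f false w = 0 :=
            eq_zero_of_mass_nonpos (hw.restrictSite f false).nonneg
              (not_lt.1 fun hu => hf ⟨hfe, hv, hu⟩)
          have : _root_.restrictSite f true w₁ = w₁ := by
            rw [hw₁, restrictSite_comm, restrictSite_of_eq f true hu]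
          rw [this]; ring
        · have : _root_.restrictSite f true w₁ = 0 :=
            eq_zero_of_mass_nonpos (gw₁.restrictSite f true).nonneg (not_lt.1 hv)
          rw [this]; simp [wsum, mass])) hK
    have gu := hw.restrictSite f false
    have gv := hw.restrictSite f true
    have hnc := hw.mass_mul_le hfe.symm
    rw [hw₁, restrictSite_comm] at hv
    have hvm : 0 < mass (_root_.restrictSite f true w) := by
      rw [mass_split e]
      have := mass_nonneg (gv.restrictSite e false).nonneg
      linarith
    -- Although `hu` concerns `w` only, negative correlation of `e` and `f` forces a vacant `f` to
    -- be possible also when `e` is occupied.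
    have heu : 0 < mass (_root_.restrictSite e true (_root_.restrictSite f false w)) := by
      have := mul_pos hv hu
      exact pos_of_mul_pos_right (this.trans_le hnc) hvm.le
    have ne_of_pos : ∀ {v : SiteState Λ → ℝ}, 0 < mass v → v ≠ 0 := by
      rintro v hv rfl; simp [mass] at hv
    have hIu := ih _ (card_support_restrictSite_lt f false (ne_of_pos hvm)) gu rfl
    have hIv := ih _ (card_support_restrictSite_lt f true (ne_of_pos hu)) gv rfl
    rw [wsum_split f w₁, mass_split f w₁, hw₁, restrictSite_comm f e, restrictSite_comm f e]
      at hcov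
    rw [wsum_split f w₁, mass_split f w₁, wsum_split f w, mass_split f w, hw₁,
      restrictSite_comm f e, restrictSite_comm f e]
    set mu := mass (_root_.restrictSite f false w)
    set mv := mass (_root_.restrictSite f true w)
    set eu := mass (_root_.restrictSite e true (_root_.restrictSite f false w))
    set ev := mass (_root_.restrictSite e true (_root_.restrictSite f true w))
    set Gu := wsum (_root_.restrictSite e true (_root_.restrictSite f false w)) F
    set Gv := wsum (_root_.restrictSite e true (_root_.restrictSite f true w)) F
    set Fu := wsum (_root_.restrictSite f false w) F
    set Fv := wsum (_root_.restrictSite f true w) F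
    -- Occupying `e` makes `f` less likely to be occupied, while given `e` an occupied `f` favours
    -- `F`; this is `k1`. The induction hypotheses for the two values of `f` give `k2` and `k3`. The
    -- scaled goal is `k2 + k3` with the product in `k1` dropped from the left side.
    refine le_of_mul_le_mul_left ?_ (mul_pos heu hv)
    have k1 : 0 ≤ (mv * eu - mu * ev) * (Gv * eu - Gu * ev) :=
      mul_nonneg (by linarith) (by linarith)
    have k2 := mul_le_mul_of_nonneg_left hIu (mul_nonneg (add_pos heu hv).le hv.le)
    have k3 := mul_le_mul_of_nonneg_left hIv (mul_nonneg (add_pos heu hv).le heu.le)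
    linarith
  · push Not at hK
    -- Every `f ≠ e` occupied in a state charged by `w₁` is now occupied in all states charged by
    -- `w`. Hence `S` lies below `S'` with `e` filled, and `F` does not see `e`.
    have hle : ∀ S S', w₁ S ≠ 0 → w S' ≠ 0 → F S ≤ F S' := by
      intro S S' hS hS'
      have h1 : F S' = F (Function.update S' e true) := by
        refine hFA fun i hi => ?_
        rw [Function.update_of_ne (ne_of_mem_of_not_mem hi he)]
      rw [h1]
      apply hF
      intro f
      by_cases hfe : f = e
      · subst hfe; simp
      rw [Function.update_of_ne hfe]
      cases hSf : S f
      · simp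
      have hp : 0 < mass (_root_.restrictSite f true w₁) :=
        mass_pos (gw₁.restrictSite f true).nonneg (S := S) (by simpa [_root_.restrictSite, hSf])
      have hz := eq_zero_of_mass_nonpos (hw.restrictSite f false).nonneg (hK f hfe hp)
      cases hSf' : S' f
      · have := congrFun hz S'
        simp [_root_.restrictSite, hSf'] at this
        exact absurd this hS'
      · simp
    rw [wsum, mass, wsum, mass, Finset.sum_mul_sum, Finset.sum_mul_sum,
      Finset.sum_comm (f := fun S S' => w S * F S * w₁ S')]
    refine Finset.sum_le_sum fun S _ => Finset.sum_le_sum fun S' _ => ?_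
    by_cases h1 : w₁ S = 0
    · simp [h1]
    by_cases h2 : w S' = 0
    · simp [h2]
    have := mul_le_mul_of_nonneg_left (hle S S' h1 h2) (mul_nonneg (gw₁.nonneg S) (hw.nonneg S'))
    linarith

/-- Increasing functions of disjoint sets of sites are negatively correlated. -/
lemma IsConservativeStable.wsum_mul_mass_le {w : SiteState Λ → ℝ}
    (hw : IsConservativeStable w) {F G : SiteState Λ → ℝ} (hF : Monotone F) (hG : Monotone G)
    {A B : Set Λ} (hFA : DependsOn F A) (hGB : DependsOn G B) (hAB : Disjoint A B) :
    wsum w (F * G) * mass w ≤ wsum w F * wsum w G := by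
  induction hn : (Finset.univ.filter fun S => w S ≠ 0).card using Nat.strong_induction_on
    generalizing w with
  | _ n ih =>
  subst hn
  by_cases hK : ∃ f, f ∈ B ∧ 0 < mass (_root_.restrictSite f true w) ∧
      0 < mass (_root_.restrictSite f false w)
  -- The covariance of `G` is non-positive with sites outside `B` and zero with constant sites, so a
  -- varying site `f` of `B` has non-negative covariance with `G`. As `F` ignores `f`, its
  -- covariance with `f` is non-positive.
  · obtain ⟨f, ⟨hfB, hv, hu⟩, hcov⟩ := exists_nonneg_of_sum_nonneg
      (hw.sum_cov_eq_zero G).ge (fun f hf => (by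
        by_cases hfB : f ∈ B
        · apply le_of_eq
          by_cases hv : 0 < mass (_root_.restrictSite f true w)
          · have hu : _root_.restrictSite f false w = 0 :=
              eq_zero_of_mass_nonpos (hw.restrictSite f false).nonneg
                (not_lt.1 fun hu => hf ⟨hfB, hv, hu⟩)
            rw [restrictSite_of_eq f true hu]; ring
          · have : _root_.restrictSite f true w = 0 :=
              eq_zero_of_mass_nonpos (hw.restrictSite f true).nonneg (not_lt.1 hv)
            rw [this]; simp [wsum, mass]
        · exact sub_nonpos.2 (hw.wsum_restrictSite_mul_mass_le hG hGB hfB))) hK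
    have gu := hw.restrictSite f false
    have gv := hw.restrictSite f true
    have hFf := hw.wsum_restrictSite_mul_mass_le hF hFA (hAB.notMem_of_mem_right hfB)
    have ne_of_pos : ∀ {v : SiteState Λ → ℝ}, 0 < mass v → v ≠ 0 := by
      rintro v hv rfl; simp [mass] at hv
    have hIu := ih _ (card_support_restrictSite_lt f false (ne_of_pos hv)) gu rfl
    have hIv := ih _ (card_support_restrictSite_lt f true (ne_of_pos hu)) gv rfl
    rw [wsum_split f w, mass_split f w] at hcov hFf
    rw [wsum_split f w, mass_split f w, wsum_split f w F, wsum_split f w G]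
    set mu := mass (_root_.restrictSite f false w)
    set mv := mass (_root_.restrictSite f true w)
    set Gu := wsum (_root_.restrictSite f false w) G
    set Gv := wsum (_root_.restrictSite f true w) G
    set Fu := wsum (_root_.restrictSite f false w) F
    set Fv := wsum (_root_.restrictSite f true w) F
    set Hu := wsum (_root_.restrictSite f false w) (F * G)
    set Hv := wsum (_root_.restrictSite f true w) (F * G)
    -- Law of total covariance: `k1` is the part between the two values of `f`, with factors of
    -- known sign; `k2` and `k3` are the parts within them.
    refine le_of_mul_le_mul_left ?_ (mul_pos hu hv)
    have k1 : 0 ≤ (Gv * mu - Gu * mv) * (Fu * mv - Fv * mu) :=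
      mul_nonneg (by linarith) (by linarith)
    have k2 := mul_le_mul_of_nonneg_left hIu (mul_nonneg (add_pos hu hv).le hv.le)
    have k3 := mul_le_mul_of_nonneg_left hIv (mul_nonneg (add_pos hu hv).le hu.le)
    linarith
  · push Not at hK
    -- No site of `B` varies on the support, so `G` is constant there.
    have hconst : ∀ S S', w S ≠ 0 → w S' ≠ 0 → G S = G S' := by
      intro S S' hS hS'
      refine hGB fun f hf => ?_
      by_contra hne
      obtain ⟨T, T', hT, hT', h1, h2⟩ : ∃ T T', w T ≠ 0 ∧ w T' ≠ 0 ∧ T f = true ∧ T' f = false := by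
        cases h : S f
        · exact ⟨S', S, hS', hS, by simpa [h] using Ne.symm hne, h⟩
        · exact ⟨S, S', hS, hS', h, by simpa [h] using Ne.symm hne⟩
      have hp : 0 < mass (_root_.restrictSite f true w) :=
        mass_pos (hw.restrictSite f true).nonneg (S := T) (by simpa [_root_.restrictSite, h1])
      have hq : 0 < mass (_root_.restrictSite f false w) :=
        mass_pos (hw.restrictSite f false).nonneg (S := T') (by simpa [_root_.restrictSite, h2])
      exact absurd (hK f hf hp) (not_le.2 hq)
    apply le_of_eq
    rw [wsum, mass, wsum, wsum, Finset.sum_mul_sum, Finset.sum_mul_sum]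
    refine Finset.sum_congr rfl fun S _ => Finset.sum_congr rfl fun S' _ => ?_
    by_cases h1 : w S = 0
    · simp [h1]
    by_cases h2 : w S' = 0
    · simp [h2]
    rw [Pi.mul_apply, hconst S S' h1 h2]
    ring

end NegativeAssociation

/-! ### Probability measures with stable weights. -/

section StableWeights

variable {Λ : Type*} [Fintype Λ] [DecidableEq Λ]

/-- Non-negative half-plane stable weights that are carried by states with a fixed number of
particles. -/
structure IsStableWeight (w : SiteState Λ → ℝ) : Prop where
  nonneg : ∀ S, 0 ≤ w S
  stable : HalfPlaneStable w
  homogeneous : ∃ m : ℝ, ∀ S, w S ≠ 0 → (∑ i, if S i then (1 : ℝ) else 0) = m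

lemma IsStableWeight.isConservativeStable {w : SiteState Λ → ℝ} (hw : IsStableWeight w) :
    IsConservativeStable w :=
  ⟨hw.nonneg, hw.stable.weaklyStable, hw.homogeneous⟩

lemma isStableWeight_single (S₀ : SiteState Λ) : IsStableWeight (Pi.single S₀ (1 : ℝ)) := by
  refine ⟨fun S => ?_, halfPlaneStable_single S₀, ∑ i, if S₀ i then (1 : ℝ) else 0, fun S hS => ?_⟩
  · by_cases h : S = S₀
    · subst h; simp
    · simp [Pi.single_eq_of_ne h]
  · by_cases h : S = S₀
    · rw [h]
    · simp [Pi.single_eq_of_ne h] at hS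

lemma IsStableWeight.partialSwap {w : SiteState Λ → ℝ} (hw : IsStableWeight w) {p : ℝ}
    (hp : 0 ≤ p) (hp1 : p ≤ 1) {i j : Λ} (hij : i ≠ j) :
    IsStableWeight (partialSwap p (Equiv.swap i j) w) := by
  obtain ⟨m, hm⟩ := hw.homogeneous
  refine ⟨fun S => ?_, hw.stable.partialSwap hp hp1 hij, m, fun S hS => ?_⟩
  · simp only [_root_.partialSwap, Pi.add_apply, Pi.smul_apply, smul_eq_mul]
    exact add_nonneg (mul_nonneg (sub_nonneg.2 hp1) (hw.nonneg _)) (mul_nonneg hp (hw.nonneg _))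
  · by_cases h : w S = 0
    · have h' : w (S ∘ Equiv.swap i j) ≠ 0 := by
        intro h'
        simp [_root_.partialSwap, h, h'] at hS
      rw [← hm _ h']
      exact (Equiv.sum_comp (Equiv.swap i j) fun k => if S k then (1 : ℝ) else 0).symm
    · exact hm S h

lemma wsum_indicator (μ : Measure (SiteState Λ)) [IsFiniteMeasure μ] (E : Set (SiteState Λ)) :
    wsum (fun S => μ.real {S}) (E.indicator 1) = μ.real E := by
  classical
  have : (E.toFinite.toFinset : Set (SiteState Λ)) = E := by simp
  conv_rhs => rw [← this, ← sum_measureReal_singleton]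
  simp [wsum, Set.indicator_apply, ← Finset.sum_filter]

/-- A probability measure whose weights are stable is negatively associated. -/
lemma negativelyAssociated_of_isStableWeight {μ : Measure (SiteState Λ)} [IsProbabilityMeasure μ]
    (h : IsStableWeight fun S => μ.real {S}) : NegativelyAssociated μ := by
  rintro ℰ ℱ hℰ hℱ ⟨A, B, -, hAB, ⟨ℰ', rfl⟩, ⟨ℱ', rfl⟩⟩
  have hmono : ∀ {U : Set (SiteState Λ)}, IsUpperSet U → Monotone (U.indicator (1 : SiteState Λ → ℝ)) := by
    intro U hU S T hST
    by_cases hS : S ∈ U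
    · simp [hS, hU hST hS]
    · simp only [Set.indicator_of_notMem hS]
      exact Set.indicator_nonneg (fun _ _ => zero_le_one) T
  have hdep : ∀ (C : Set Λ) (V : Set (SiteState C)),
      DependsOn (Set.indicator {S : SiteState Λ | (fun i : C => S i) ∈ V} (1 : SiteState Λ → ℝ)) C := by
    intro C V S T hST
    have : (fun i : C => S i) = fun i : C => T i := funext fun i => hST i i.2
    show V.indicator 1 (fun i : C => S i) = V.indicator (1 : SiteState C → ℝ) fun i : C => T i
    rw [this]
  have key := h.isConservativeStable.wsum_mul_mass_le (hmono hℰ) (hmono hℱ) (hdep A ℰ')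
    (hdep B ℱ') (Set.disjoint_iff_inter_eq_empty.2 hAB)
  have hmass : mass (fun S => μ.real {S}) = 1 := by
    simp [mass]
  rw [← Set.inter_indicator_one, wsum_indicator, wsum_indicator, wsum_indicator, hmass, mul_one] at key
  rw [← ENNReal.toReal_le_toReal (measure_ne_top _ _)
    (ENNReal.mul_ne_top (measure_ne_top _ _) (measure_ne_top _ _)), ENNReal.toReal_mul]
  exact key

end StableWeights

/-! ### Transpositions applied independent random numbers of times. -/

section JumpChain

variable {Λ : Type*} {ι : Type*}

/-- The state obtained from `S₀` by applying, for the indices `x` in the list from the last one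
to the first one, the permutation `σ x` exactly `d x` times. -/
def jumpState (σ : ι → Equiv.Perm Λ) (d : ι → ℕ) (S₀ : SiteState Λ) : List ι → SiteState Λ
  | [] => S₀
  | x :: L => jumpState σ d S₀ L ∘ (σ x ^ d x : Equiv.Perm Λ)

lemma jumpState_append (σ : ι → Equiv.Perm Λ) (d : ι → ℕ) (S₀ : SiteState Λ) (L L' : List ι) :
    jumpState σ d S₀ (L ++ L') = jumpState σ d (jumpState σ d S₀ L') L := by
  induction L with
  | nil => rfl
  | cons x L ih => simp [jumpState, ih]

lemma jumpState_congr (σ : ι → Equiv.Perm Λ) {d d' : ι → ℕ} (S₀ : SiteState Λ) {L : List ι}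
    (h : ∀ x ∈ L, d x = d' x) : jumpState σ d S₀ L = jumpState σ d' S₀ L := by
  induction L with
  | nil => rfl
  | cons x L ih =>
    rw [jumpState, jumpState, ih fun y hy => h y (List.mem_cons_of_mem x hy),
      h x List.mem_cons_self]

lemma jumpState_of_eq_zero (σ : ι → Equiv.Perm Λ) {d : ι → ℕ} (S₀ : SiteState Λ) {L : List ι}
    (h : ∀ x ∈ L, d x = 0) : jumpState σ d S₀ L = S₀ := by
  induction L with
  | nil => rfl
  | cons x L ih =>
    rw [jumpState, ih fun y hy => h y (List.mem_cons_of_mem x hy), h x List.mem_cons_self]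
    simp

lemma jumpState_of_eq_one (σ : ι → Equiv.Perm Λ) {d : ι → ℕ} (S₀ : SiteState Λ) {L : List ι}
    (hL : L.Nodup) {x : ι} (hx : x ∈ L) (h1 : d x = 1) (h0 : ∀ y ∈ L, y ≠ x → d y = 0) :
    jumpState σ d S₀ L = S₀ ∘ σ x := by
  induction L with
  | nil => simp at hx
  | cons y L ih =>
    rw [List.nodup_cons] at hL
    by_cases hyx : y = x
    · subst hyx
      rw [jumpState, jumpState_of_eq_zero, h1, pow_one]
      exact fun z hz => h0 z (List.mem_cons_of_mem y hz) (ne_of_mem_of_not_mem hz hL.1)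
    · rw [jumpState, h0 y List.mem_cons_self hyx, ih hL.2
        ((List.mem_cons.1 hx).resolve_left (Ne.symm hyx))
        fun z hz => h0 z (List.mem_cons_of_mem y hz)]
      simp

variable [Fintype Λ] {Ω : Type*} [MeasurableSpace Ω] {P : Measure Ω} [IsProbabilityMeasure P]

/-- Applying an involution a random, independent number of times is a partial swap of the law. -/
lemma real_map_comp_pow {Y : Ω → SiteState Λ} {D : Ω → ℕ} (hY : Measurable Y) (hD : Measurable D)
    (hYD : IndepFun Y D P) {τ : Equiv.Perm Λ} (hτ : τ ^ 2 = 1) :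
    (fun S => (P.map fun ω => Y ω ∘ (τ ^ D ω : Equiv.Perm Λ)).real {S}) =
      partialSwap (P.real (D ⁻¹' {n | Odd n})) τ fun S => (P.map Y).real {S} := by
  have hm : Measurable fun ω => Y ω ∘ (τ ^ D ω : Equiv.Perm Λ) :=
    (Measurable.of_discrete (f := fun x : SiteState Λ × ℕ => x.1 ∘ (τ ^ x.2 : Equiv.Perm Λ))).comp
      (hY.prodMk hD)
  have hττ : ∀ S : SiteState Λ, (S ∘ τ) ∘ τ = S := fun S => by
    have : τ * τ = 1 := by rw [← sq, hτ]
    ext i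
    have := Equiv.congr_fun this i
    simp only [Equiv.Perm.mul_apply, Equiv.Perm.one_apply] at this
    simp [this]
  -- Only the parity of the exponent matters.
  have hodd : ∀ n, Odd n → τ ^ n = τ := by
    rintro n ⟨k, rfl⟩; rw [pow_succ, pow_mul, hτ]; simp
  have heven : ∀ n, ¬ Odd n → τ ^ n = 1 := by
    intro n hn
    obtain ⟨k, rfl⟩ := (Nat.not_odd_iff_even.1 hn).two_dvd
    rw [pow_mul, hτ]; simp
  ext S
  have hset : (fun ω => Y ω ∘ (τ ^ D ω : Equiv.Perm Λ)) ⁻¹' {S} =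
      (Y ⁻¹' {S} ∩ D ⁻¹' {n | Odd n}ᶜ) ∪ (Y ⁻¹' {S ∘ τ} ∩ D ⁻¹' {n | Odd n}) := by
    ext ω
    by_cases hω : Odd (D ω)
    · have : Y ω ∘ τ = S ↔ Y ω = S ∘ τ :=
        ⟨fun h => by rw [← h, hττ], fun h => by rw [h, hττ]⟩
      simp [hω, hodd _ hω, this]
    · simp [hω, heven _ hω]
  have hmO : MeasurableSet (D ⁻¹' {n | Odd n}) := hD .of_discrete
  have hmS : ∀ S, MeasurableSet (Y ⁻¹' {S}) := fun S => hY .of_discrete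
  rw [map_measureReal_apply hm .of_discrete, hset, measureReal_union
    (Set.disjoint_left.2 fun ω h h' => h.2 h'.2) ((hmS _).inter hmO)]
  simp only [partialSwap, Pi.add_apply, Pi.smul_apply, smul_eq_mul]
  rw [map_measureReal_apply hY .of_discrete, map_measureReal_apply hY .of_discrete]
  have hi : ∀ (s : Set (SiteState Λ)) (t : Set ℕ),
      P.real (Y ⁻¹' s ∩ D ⁻¹' t) = P.real (Y ⁻¹' s) * P.real (D ⁻¹' t) := fun s t => by
    simp only [measureReal_def]
    rw [hYD.measure_inter_preimage_eq_mul _ _ .of_discrete .of_discrete, ENNReal.toReal_mul]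
  rw [hi, hi, Set.preimage_compl, probReal_compl_eq_one_sub hmO]
  ring

lemma measurable_jumpState (σ : ι → Equiv.Perm Λ) {D : ι → Ω → ℕ} (hD : ∀ x, Measurable (D x))
    (S₀ : SiteState Λ) (L : List ι) :
    Measurable fun ω => jumpState σ (fun x => D x ω) S₀ L := by
  induction L with
  | nil => exact measurable_const
  | cons x L ih =>
    exact (Measurable.of_discrete
      (f := fun y : SiteState Λ × ℕ => y.1 ∘ (σ x ^ y.2 : Equiv.Perm Λ))).comp (ih.prodMk (hD x))

/-- Starting from a deterministic state, transpositions that are applied independent random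
numbers of times lead to a state with a stable law. -/
lemma isStableWeight_jumpState [DecidableEq Λ] [DecidableEq ι] {σ : ι → Equiv.Perm Λ}
    (hσ : ∀ x, ∃ i j, i ≠ j ∧ σ x = Equiv.swap i j) {D : ι → Ω → ℕ}
    (hD : ∀ x, Measurable (D x)) (hind : iIndepFun D P) (S₀ : SiteState Λ) {L : List ι}
    (hL : L.Nodup) :
    IsStableWeight fun S => (P.map fun ω => jumpState σ (fun x => D x ω) S₀ L).real {S} := by
  induction L with
  | nil =>
    convert isStableWeight_single S₀ using 1
    ext S
    simp only [jumpState]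
    rw [map_measureReal_apply measurable_const .of_discrete]
    by_cases h : S = S₀
    · subst h; simp
    · simp [Pi.single_eq_of_ne h, Set.preimage_const_of_notMem (fun h' => h (Eq.symm h') : S₀ ∉ {S})]
  | cons x L ih =>
    rw [List.nodup_cons] at hL
    obtain ⟨i, j, hij, hσx⟩ := hσ x
    have hYD : IndepFun (fun ω => jumpState σ (fun x => D x ω) S₀ L) (D x) P := by
      -- As `x` is not in `L`, the state built from `L` is a function of counts other than `D x`;
      -- the default `0` outside `L` is never read.
      have h := hind.indepFun_finset L.toFinset {x} (by simpa using hL.1) hD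
      have h2 := h.comp
        (φ := fun d => jumpState σ (fun y => if hy : y ∈ L.toFinset then d ⟨y, hy⟩ else 0) S₀ L)
        (ψ := fun d => d ⟨x, Finset.mem_singleton_self x⟩) .of_discrete .of_discrete
      convert h2 using 1
      · ext1 ω
        refine jumpState_congr σ S₀ fun y hy => ?_
        simp [hy]
      · rfl
    simp only [jumpState]
    rw [real_map_comp_pow (measurable_jumpState σ hD S₀ L) (hD x) hYD
      (by rw [hσx, sq, Equiv.swap_mul_self]), hσx]
    exact (ih hL.2).partialSwap measureReal_nonneg measureReal_le_one hij

end JumpChain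

/-! ### Tail bounds for the Poisson law. -/

section Poisson

lemma poissonMeasure_real_Ici_one_le (r : ℝ≥0) : (poissonMeasure r).real (Set.Ici 1) ≤ r := by
  have : (Set.Ici 1 : Set ℕ) = {0}ᶜ := by ext n; simp [Nat.one_le_iff_ne_zero]
  rw [this, probReal_compl_eq_one_sub .of_discrete, poissonMeasure_real_singleton]
  have := Real.add_one_le_exp (-(r : ℝ))
  simp
  linarith

/-- `1 - exp (-r) * (1 + r) ≤ 1 - (1 - r) * (1 + r) = r ^ 2`. -/
lemma poissonMeasure_real_Ici_two_le (r : ℝ≥0) : (poissonMeasure r).real (Set.Ici 2) ≤ r ^ 2 := by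
  have : (Set.Ici 2 : Set ℕ) = ({0} ∪ {1})ᶜ := by
    ext n
    simp only [Set.mem_Ici, Set.mem_compl_iff, Set.mem_union, Set.mem_singleton_iff]
    omega
  rw [this, probReal_compl_eq_one_sub .of_discrete, measureReal_union (by simp) .of_discrete,
    poissonMeasure_real_singleton, poissonMeasure_real_singleton]
  have h := mul_le_mul_of_nonneg_right (Real.add_one_le_exp (-(r : ℝ)))
    (add_nonneg zero_le_one r.coe_nonneg)
  simp
  nlinarith

end Poisson

/-! ### Paths observed on a discrete time grid. -/

section TimeGrid

/-- The pairs of a clock and a time step, for the first `n` time steps; later steps come first. -/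
noncomputable def gridList {ε : Type*} [Fintype ε] : ℕ → List (ε × ℕ)
  | 0 => []
  | n + 1 => (Finset.univ.toList.map fun e => (e, n)) ++ gridList n

lemma lt_of_mem_gridList {ε : Type*} [Fintype ε] {n : ℕ} {x : ε × ℕ} (hx : x ∈ gridList n) :
    x.2 < n := by
  induction n with
  | zero => simp [gridList] at hx
  | succ n ih =>
    rw [gridList, List.mem_append] at hx
    rcases hx with hx | hx
    · obtain ⟨e, -, rfl⟩ := List.mem_map.1 hx
      exact n.lt_succ_self
    · exact (ih hx).trans n.lt_succ_self

lemma nodup_map_toList {ε : Type*} [Fintype ε] (n : ℕ) :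
    ((Finset.univ : Finset ε).toList.map fun e => (e, n)).Nodup :=
  (Finset.nodup_toList _).map fun _ _ h => congrArg Prod.fst h

lemma nodup_gridList {ε : Type*} [Fintype ε] (n : ℕ) : (gridList n : List (ε × ℕ)).Nodup := by
  induction n with
  | zero => simp [gridList]
  | succ n ih =>
    rw [gridList, List.nodup_append]
    refine ⟨nodup_map_toList n, ih, ?_⟩
    rintro a ha b hb rfl
    obtain ⟨e, -, rfl⟩ := List.mem_map.1 ha
    exact lt_irrefl _ (lt_of_mem_gridList hb)

/-- If in each of the first `n` time steps at most one clock rings, and at most once, then the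
path is determined by the numbers of rings in these steps. -/
lemma eq_jumpState_gridList {Λ ε : Type*} [Fintype ε] (τ : ε → Equiv.Perm Λ) {d : ε × ℕ → ℕ}
    {x : ℕ → SiteState Λ} (hx0 : ∀ k, (∀ e, d (e, k) = 0) → x (k + 1) = x k)
    (hx1 : ∀ k e, d (e, k) = 1 → (∀ e', e' ≠ e → d (e', k) = 0) → x (k + 1) = x k ∘ τ e)
    {n : ℕ} (h1 : ∀ k < n, ∀ e, d (e, k) ≤ 1)
    (h2 : ∀ k < n, ∀ e e', e ≠ e' → d (e, k) = 0 ∨ d (e', k) = 0) :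
    x n = jumpState (fun y => τ y.1) d (x 0) (gridList n) := by
  induction n with
  | zero => rfl
  | succ n ih =>
    rw [gridList, jumpState_append, ← ih (fun k hk => h1 k (hk.trans n.lt_succ_self))
      (fun k hk => h2 k (hk.trans n.lt_succ_self))]
    -- At most one clock rings in the step, so the arbitrary order of the clocks within it is
    -- harmless.
    by_cases h : ∀ e, d (e, n) = 0
    · rw [hx0 n h, jumpState_of_eq_zero]
      intro y hy
      obtain ⟨e, -, rfl⟩ := List.mem_map.1 hy
      exact h e
    · push Not at h
      obtain ⟨e, he⟩ := h
      have he1 : d (e, n) = 1 := by have := h1 n n.lt_succ_self e; omega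
      have h0 : ∀ e', e' ≠ e → d (e', n) = 0 := fun e' he' =>
        (h2 n n.lt_succ_self e' e he').resolve_right he
      rw [hx1 n e he1 h0, jumpState_of_eq_one _ _ (nodup_map_toList n) (x := (e, n)) (by simp) he1]
      intro y hy hye
      obtain ⟨e', -, rfl⟩ := List.mem_map.1 hy
      exact h0 e' fun h => hye (by rw [h])

end TimeGrid

/-! ### Discretisation of the exclusion process. -/

section Exclusion

lemma exists_pairSwap_eq_swap {Λ : Type*} [DecidableEq Λ] {G : SimpleGraph Λ} (e : G.edgeSet) :
    ∃ i j, i ≠ j ∧ pairSwap (e : Sym2 Λ) = Equiv.swap i j := by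
  obtain ⟨e, he⟩ := e
  induction e using Sym2.ind with
  | _ i j => exact ⟨i, j, G.ne_of_adj he, rfl⟩

/-- The number of rings of the clock `y.1` in the time interval `(y.2 * h, (y.2 + 1) * h]`. -/
def gridIncrement {Ω ε : Type*} (N : ε → ℝ≥0 → Ω → ℕ) (h : ℝ≥0) (y : ε × ℕ) (ω : Ω) : ℕ :=
  N y.1 ((y.2 + 1 : ℕ) * h) ω - N y.1 (y.2 * h) ω

variable {Λ : Type*} [DecidableEq Λ] {Ω : Type*} [MeasurableSpace Ω] {P : Measure Ω}
  {G : SimpleGraph Λ} {rate : G.edgeSet → ℝ≥0} {N : G.edgeSet → ℝ≥0 → Ω → ℕ}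
  {X : ℝ≥0 → Ω → SiteState Λ}

lemma grid_mono (h : ℝ≥0) : Monotone fun k : ℕ => (k : ℝ≥0) * h := fun a b hab => by
  have : (a : ℝ≥0) ≤ b := by exact_mod_cast hab
  exact mul_le_mul_left this h

lemma IsSymmetricExclusionProcess.measurable_gridIncrement
    (hX : IsSymmetricExclusionProcess P G rate N X) (h : ℝ≥0) (y : G.edgeSet × ℕ) :
    Measurable (gridIncrement N h y) :=
  ((hX.clock y.1).measurable _).sub ((hX.clock y.1).measurable _)

/-- Independence across clocks combines with independent increments along each clock. -/
lemma IsSymmetricExclusionProcess.iIndepFun_gridIncrement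
    (hX : IsSymmetricExclusionProcess P G rate N X) (h : ℝ≥0) :
    iIndepFun (gridIncrement N h) P := by
  refine iIndepFun_uncurry' (X := fun e k => gridIncrement N h (e, k))
    (fun e k => hX.measurable_gridIncrement h (e, k)) ?_ fun e => ?_
  · exact hX.indepClocks.comp
      (fun _ (f : ℝ≥0 → ℕ) (k : ℕ) => f ((k + 1 : ℕ) * h) - f (k * h))
      fun _ => by fun_prop
  · exact (hX.clock e).indepIncrements.nat (grid_mono h)

lemma IsSymmetricExclusionProcess.real_gridIncrement
    (hX : IsSymmetricExclusionProcess P G rate N X) (h : ℝ≥0) (y : G.edgeSet × ℕ) (s : Set ℕ) :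
    P.real (gridIncrement N h y ⁻¹' s) = (poissonMeasure (rate y.1 * h)).real s := by
  have := (hX.clock y.1).law _ _ (grid_mono h y.2.le_succ)
  have e : ((y.2.succ : ℝ≥0) * h - y.2 * h) = h := by
    rw [Nat.succ_eq_add_one, Nat.cast_add, add_mul, Nat.cast_one, one_mul, add_tsub_cancel_left]
  rw [e] at this
  rw [← this]
  exact (map_measureReal_apply (hX.measurable_gridIncrement h y) .of_discrete).symm

variable [Fintype G.edgeSet]

/-- The event that in one of the first `n` time steps two rings occur. -/
def collision {Ω ε : Type*} (N : ε → ℝ≥0 → Ω → ℕ) (h : ℝ≥0) (n : ℕ) : Set Ω :=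
  {ω | ∃ k < n, (∃ e, 2 ≤ gridIncrement N h (e, k) ω) ∨
    ∃ e e', e ≠ e' ∧ 1 ≤ gridIncrement N h (e, k) ω ∧ 1 ≤ gridIncrement N h (e', k) ω}

/-- A union bound: in a step of length `h`, a double ring of one clock, or rings of two distinct
clocks, have probability of order `h ^ 2`. -/
lemma IsSymmetricExclusionProcess.collision_le [IsProbabilityMeasure P]
    (hX : IsSymmetricExclusionProcess P G rate N X) (h : ℝ≥0) (n : ℕ) :
    P.real (collision N h n) ≤ n * ((∑ e, (rate e : ℝ) ^ 2 +
      ∑ e, ∑ e', (rate e : ℝ) * rate e') * h ^ 2) := by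
  classical
  have hsub : collision N h n ⊆ ⋃ k ∈ Finset.range n,
      ((⋃ e ∈ (Finset.univ : Finset G.edgeSet), gridIncrement N h (e, k) ⁻¹' Set.Ici 2) ∪
      ⋃ e ∈ (Finset.univ : Finset G.edgeSet), ⋃ e' ∈ Finset.univ.filter (e ≠ ·),
        (gridIncrement N h (e, k) ⁻¹' Set.Ici 1 ∩ gridIncrement N h (e', k) ⁻¹' Set.Ici 1)) := by
    rintro ω ⟨k, hk, hω⟩
    simp only [Set.mem_iUnion, Set.mem_union, Finset.mem_range, Set.mem_preimage, Set.mem_Ici,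
      Set.mem_inter_iff, Finset.mem_univ, Finset.mem_filter, true_and, exists_prop]
    exact ⟨k, hk, hω⟩
  refine (measureReal_mono hsub (measure_ne_top _ _)).trans ((measureReal_biUnion_finset_le _ _).trans ?_)
  refine (Finset.sum_le_card_nsmul _ _ _ fun k _ => ?_).trans_eq
    (by rw [Finset.card_range, nsmul_eq_mul])
  refine (measureReal_union_le _ _).trans ?_
  rw [add_mul, Finset.sum_mul, Finset.sum_mul]
  refine add_le_add ((measureReal_biUnion_finset_le _ _).trans (Finset.sum_le_sum fun e _ => ?_))
    ((measureReal_biUnion_finset_le _ _).trans (Finset.sum_le_sum fun e _ => ?_))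
  · rw [hX.real_gridIncrement]
    refine (poissonMeasure_real_Ici_two_le _).trans (le_of_eq ?_)
    push_cast; ring
  · rw [Finset.sum_mul]
    refine (measureReal_biUnion_finset_le _ _).trans
      ((Finset.sum_le_sum fun e' he' => ?_).trans
        (Finset.sum_le_sum_of_subset_of_nonneg (Finset.filter_subset _ _)
          fun e' _ _ => by positivity))
    have hne : e ≠ e' := (Finset.mem_filter.1 he').2
    have hind := (hX.iIndepFun_gridIncrement h).indepFun (i := (e, k)) (j := (e', k))
      fun h => hne (congrArg Prod.fst h)
    rw [measureReal_def, hind.measure_inter_preimage_eq_mul _ _ .of_discrete .of_discrete,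
      ENNReal.toReal_mul, ← measureReal_def, ← measureReal_def, hX.real_gridIncrement,
      hX.real_gridIncrement]
    refine (mul_le_mul (poissonMeasure_real_Ici_one_le _) (poissonMeasure_real_Ici_one_le _)
      measureReal_nonneg (NNReal.coe_nonneg _)).trans (le_of_eq ?_)
    push_cast; ring

lemma IsSymmetricExclusionProcess.ae_eq_jumpState
    (hX : IsSymmetricExclusionProcess P G rate N X) {S₀ : SiteState Λ}
    (hX0 : ∀ᵐ ω ∂P, X 0 ω = S₀) (h : ℝ≥0) (n : ℕ) :
    ∀ᵐ ω ∂P, ω ∉ collision N h n → X (n * h) ω =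
      jumpState (fun y : G.edgeSet × ℕ => pairSwap (y.1 : Sym2 Λ))
        (fun y => gridIncrement N h y ω) S₀ (gridList n) := by
  have hmono : ∀ᵐ ω ∂P, ∀ e, Monotone fun t => N e t ω :=
    ae_all_iff.2 fun e => (hX.clock e).monotone
  filter_upwards [hX0, hX.noRing, hX.oneRing, hmono] with ω h0 hno hone hm hω
  -- Monotone clocks make the truncated subtraction in `gridIncrement` a true difference.
  have hstep : ∀ e (k : ℕ), N e ((k + 1 : ℕ) * h) ω =
      N e (k * h) ω + gridIncrement N h (e, k) ω := fun e k =>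
    (Nat.add_sub_cancel' (hm e (grid_mono h k.le_succ))).symm
  have := eq_jumpState_gridList (fun e : G.edgeSet => pairSwap (e : Sym2 Λ))
    (d := fun y => gridIncrement N h y ω) (x := fun k => X (k * h) ω) (n := n) ?_ ?_ ?_ ?_
  · simpa [h0] using this
  · intro k hk
    exact hno _ _ (grid_mono h k.le_succ) fun e => by
      rw [hstep, hk, add_zero]
  · intro k e he he'
    refine hone _ _ (grid_mono h k.le_succ) e ?_ fun e' hne => ?_
    · rw [hstep, he]
    · rw [hstep, he' e' hne, add_zero]
  · intro k hk e
    by_contra hlt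
    exact hω ⟨k, hk, Or.inl ⟨e, by omega⟩⟩
  · intro k hk e e' hne
    by_contra hlt
    exact hω ⟨k, hk, Or.inr ⟨e, e', hne, by omega, by omega⟩⟩

lemma real_preimage_le_add_of_ae_eq {Ω α : Type*} [MeasurableSpace Ω] {P : Measure Ω}
    [IsProbabilityMeasure P] {Y Z : Ω → α} {B : Set Ω}
    (h : ∀ᵐ ω ∂P, ω ∉ B → Y ω = Z ω) (s : Set α) :
    P.real (Y ⁻¹' s) ≤ P.real (Z ⁻¹' s) + P.real B := by
  refine le_trans ?_ (measureReal_union_le _ _)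
  refine ENNReal.toReal_mono (measure_ne_top _ _) (measure_mono_ae ?_)
  filter_upwards [h] with ω hω hY
  by_cases hB : ω ∈ B
  · exact Or.inr hB
  · left
    show Z ω ∈ s
    rw [← hω hB]
    exact hY

end Exclusion

/-! ### Refining the grid. -/

theorem theorem7p1 {Λ : Type*} [Finite Λ] [DecidableEq Λ]
    {Ω : Type*} [MeasurableSpace Ω] (P : Measure Ω) [IsProbabilityMeasure P]
    (G : SimpleGraph Λ) (rate : G.edgeSet → ℝ≥0)
    (N : G.edgeSet → ℝ≥0 → Ω → ℕ) (X : ℝ≥0 → Ω → SiteState Λ)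
    (hX : IsSymmetricExclusionProcess P G rate N X)
    (S₀ : SiteState Λ) (hX0 : ∀ᵐ ω ∂P, X 0 ω = S₀) (t : ℝ≥0) :
    NegativelyAssociated (P.map (X t)) := by
  classical
  have := Fintype.ofFinite Λ
  have := Fintype.ofFinite G.edgeSet
  intro ℰ ℱ hℰ hℱ hsupp
  -- With step length `t / n` the collision bound is `C / n`, as `n * (t / n) ^ 2 = t ^ 2 / n`.
  obtain ⟨C, hC⟩ : ∃ C : ℝ, C =
    (∑ e, (rate e : ℝ) ^ 2 + ∑ e, ∑ e', (rate e : ℝ) * rate e') * t ^ 2 := ⟨_, rfl⟩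
  have hXm := hX.measurable t
  have bound : ∀ n : ℕ, 0 < n → P.real (X t ⁻¹' (ℰ ∩ ℱ)) ≤
      (P.real (X t ⁻¹' ℰ) + C / n) * (P.real (X t ⁻¹' ℱ) + C / n) + C / n := by
    intro n hn
    have hn0 : (n : ℝ) ≠ 0 := by exact_mod_cast hn.ne'
    have hnt : (n : ℝ≥0) * (t / n) = t := mul_div_cancel₀ _ (by exact_mod_cast hn.ne')
    have hcol : P.real (collision N (t / n) n) ≤ C / n := by
      refine (hX.collision_le (t / n) n).trans (le_of_eq ?_)
      rw [hC]; push_cast; field_simp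
    have hae := hX.ae_eq_jumpState hX0 (t / n) n
    rw [hnt] at hae
    have hYm := measurable_jumpState (fun y : G.edgeSet × ℕ => pairSwap (y.1 : Sym2 Λ))
      (hX.measurable_gridIncrement (t / n)) S₀ (gridList n)
    have hstab := isStableWeight_jumpState (σ := fun y : G.edgeSet × ℕ => pairSwap (y.1 : Sym2 Λ))
      (fun y => exists_pairSwap_eq_swap y.1) (hX.measurable_gridIncrement (t / n))
      (hX.iIndepFun_gridIncrement (t / n)) S₀ (nodup_gridList n)
    set Y := fun ω => jumpState (fun y : G.edgeSet × ℕ => pairSwap (y.1 : Sym2 Λ))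
      (fun y => gridIncrement N (t / n) y ω) S₀ (gridList n)
    have : IsProbabilityMeasure (P.map Y) := Measure.isProbabilityMeasure_map hYm.aemeasurable
    have hNA := ENNReal.toReal_mono (ENNReal.mul_ne_top (measure_ne_top _ _) (measure_ne_top _ _))
      (negativelyAssociated_of_isStableWeight hstab ℰ ℱ hℰ hℱ hsupp)
    rw [ENNReal.toReal_mul, ← measureReal_def, ← measureReal_def, ← measureReal_def,
      map_measureReal_apply hYm .of_discrete, map_measureReal_apply hYm .of_discrete,
      map_measureReal_apply hYm .of_discrete] at hNA
    -- The intersection is compared from `X t` to `Y`, the single events from `Y` back to `X t`;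
    -- each comparison costs one collision probability.
    have h1 := real_preimage_le_add_of_ae_eq hae (ℰ ∩ ℱ)
    have hae' : ∀ᵐ ω ∂P, ω ∉ collision N (t / n) n → Y ω = X t ω := by
      filter_upwards [hae] with ω h hω using (h hω).symm
    have h2 := real_preimage_le_add_of_ae_eq hae' ℰ
    have h3 := real_preimage_le_add_of_ae_eq hae' ℱ
    have h4 : P.real (Y ⁻¹' ℰ) * P.real (Y ⁻¹' ℱ) ≤
        (P.real (X t ⁻¹' ℰ) + C / n) * (P.real (X t ⁻¹' ℱ) + C / n) := by
      refine mul_le_mul (by linarith) (by linarith) measureReal_nonneg ?_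
      have := measureReal_nonneg (μ := P) (s := Y ⁻¹' ℰ)
      linarith
    linarith
  have hlim : Filter.Tendsto (fun n : ℕ => (P.real (X t ⁻¹' ℰ) + C / n) *
      (P.real (X t ⁻¹' ℱ) + C / n) + C / n) Filter.atTop
      (nhds ((P.real (X t ⁻¹' ℰ) + 0) * (P.real (X t ⁻¹' ℱ) + 0) + 0)) := by
    have h0 := tendsto_const_div_atTop_nhds_zero_nat C
    exact ((h0.const_add _).mul (h0.const_add _)).add h0
  have key := ge_of_tendsto hlim (Filter.eventually_atTop.2 ⟨1, fun n hn => bound n hn⟩)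
  rw [add_zero, add_zero, add_zero] at key
  have : IsProbabilityMeasure (P.map (X t)) := Measure.isProbabilityMeasure_map hXm.aemeasurable
  rw [← ENNReal.toReal_le_toReal (measure_ne_top _ _)
    (ENNReal.mul_ne_top (measure_ne_top _ _) (measure_ne_top _ _)), ENNReal.toReal_mul,
    ← measureReal_def, ← measureReal_def, ← measureReal_def,
    map_measureReal_apply hXm .of_discrete, map_measureReal_apply hXm .of_discrete,
    map_measureReal_apply hXm .of_discrete]
  exact key
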